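/- Let $M\in\mathbb{N}=\{0,1,2,\dots\}$ and $C,L>0$. Let $\mathcal{F}_{C,M,L}$ be the class of functions $f:[0,1]\to[0,C]$ that are $M$ times continuously differentiable and satisfy $|f^{(m)}(a)-f^{(m)}(a')|\le L|a-a'|$ for all $a,a'\in[0,1]$ and all $0\le m\le M$. In the continuum-armed bandit problem with reward function $f\in\mathcal{F}_{C,M,L}$, in each round $t=1,\dots,T$ an algorithm selects an action $a_t\in[0,1]$, possibly at random, with a distribution that depends measurably on the past actions and rewards, and then receives a reward $R_t$ with conditional mean $f(a_t)$ given the past and $a_t$. The expected regret is $\mathbb{E}(R(T))=T\max_{a\in[0,1]}f(a)-\sum_{t=1}^T\mathbb{E}f(a_t)$. For $x^*\in[0,1]$ and $\delta>0$, a problem instance $\mathcal{I}(x^*,\delta)$ consists of a reward function $\nu\in\mathcal{F}_{C,M,L}$ that is a bump of height $\delta$ at $x^*$, together with scaled Bernoulli rewards: action $a$ pays $C$ with probability $\nu(a)/C$ and $0$ otherwise, independently of the past given $a$ (so the noise $R_t-\nu(a_t)$ is $(C^2/4,b)$-sub-exponential for every $b>0$, that is, $\mathbb{E}(e^{\lambda(R_t-\nu(a_t))}\mid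 a_t)\le e^{\lambda^2C^2/8}$ for $|\lambda|\le 1/b$). A bump of height $\delta$ at $x^*$ means: $\nu$ takes values in $[C/2,C/2+\delta]$, is symmetric around $x^*$ and unimodal, $\nu(x^*)=C/2+\delta$, $\nu^{(M+1)}$ exists off a finite set and is piecewise constant with values in $\{-L,0,L\}$, and $\nu(x)>C/2$ if $|x-x^*|<c_{1,M}(\delta/L)^{1/(M+1)}$ while $\nu(x)=C/2$ otherwise, where $c_{1,M}>0$ depends only on $M$. For $M=0$, $\nu(x)=\max\{C/2,\;C/2+\delta-L|x-x^*|\}$. Theorem. For every $M$ there is a constant $c_{1,M}>0$, and for all $C,L>0$ there is a constant $c=c(C,M,L)>0$, such that for every horizon $T\ge1$ and every algorithm (which may know $T,C,M,L$) there are $x^*\in[0,1]$, $\delta>0$ and a problem instance $\mathcal{I}(x^*,\delta)$ as above for which $$\mathbb{E}(R(T)\mid\mathcal{I}(x^*,\delta))\;\ge\;c\,T^{(M+2)/(2M+3)}.$$ -/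

import Mathlib

open MeasureTheory ProbabilityTheory Set

/-! ### The reward functions -/

/-- The class `F_{C,M,L}` of functions `f : [0,1] → [0,C]` that possess derivatives up to order `M`
on `[0,1]` (one-sided at the end points) such that `f^{(m)}` is `L`-Lipschitz for every `m ≤ M`.
The derivatives are those of an extension of `f` to the line, taken within `[0,1]`, so that only the
values of `f` on `[0,1]` enter. -/
def smoothRewards (C : ℝ) (M : ℕ) (L : ℝ) : Set C(unitInterval, ℝ) :=
  {f | (∀ a, f a ∈ Icc 0 C) ∧
    ContDiffOn ℝ M (IccExtend zero_le_one f) (Icc 0 1) ∧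
    ∀ m ≤ M, ∀ a ∈ Icc (0 : ℝ) 1, ∀ a' ∈ Icc (0 : ℝ) 1,
      |iteratedDerivWithin m (IccExtend zero_le_one f) (Icc 0 1) a -
        iteratedDerivWithin m (IccExtend zero_le_one f) (Icc 0 1) a'| ≤ L * |a - a'|}

/-- `ν` is a bump of height `δ` at `x` over the base line `C / 2`, with support radius `r`: it takes
values in `[C/2, C/2 + δ]`, is symmetric around `x` and unimodal, attains `C/2 + δ` at `x`, exceeds
`C/2` at the points at distance less than `r` from `x` and equals `C/2` at all others, and its
`(M+1)`-th derivative exists off a finite set and is piecewise constant with values in `{-L, 0, L}`.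
(A derivative with finitely many values is constant on each interval, by Darboux's theorem.)
For `M = 0` it is the tent function of slope `L`. -/
structure IsBump (C : ℝ) (M : ℕ) (L : ℝ) (x : unitInterval) (δ r : ℝ) (ν : C(unitInterval, ℝ)) :
    Prop where
  mem_Icc : ∀ a, ν a ∈ Icc (C / 2) (C / 2 + δ)
  apply_center : ν x = C / 2 + δ
  symmetric : ∀ a a' : unitInterval, |(a : ℝ) - x| = |(a' : ℝ) - x| → ν a = ν a'
  monotone_left : MonotoneOn ν (Iic x)
  antitone_right : AntitoneOn ν (Ici x)
  above : ∀ a : unitInterval, |(a : ℝ) - x| < r → C / 2 < ν a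
  base : ∀ a : unitInterval, r ≤ |(a : ℝ) - x| → ν a = C / 2
  piecewise : ∃ S : Set ℝ, S.Finite ∧ ∀ a ∈ Ioo (0 : ℝ) 1 \ S, ∃ d ∈ ({-L, 0, L} : Set ℝ),
    HasDerivAt (iteratedDerivWithin M (IccExtend zero_le_one ν) (Icc 0 1)) d a
  tent : M = 0 → ∀ a : unitInterval, ν a = max (C / 2) (C / 2 + δ - L * |(a : ℝ) - x|)

/-! ### Rewards and noise -/

/-- Bernoulli rewards scaled to `{0, C}`: playing `a` pays `C` with probability `f a / C`, and `0`
otherwise. For `0 ≤ f ≤ C` the projection to `[0,1]` does nothing and the mean reward is `f a`. -/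
noncomputable def bernoulliReward (C : ℝ) (f : C(unitInterval, ℝ)) : Kernel unitInterval ℝ where
  toFun a := bernoulliMeasure C 0 (projIcc 0 1 zero_le_one (f a / C))
  measurable' := by
    have h : Measurable fun a : unitInterval =>
        projIcc (0 : ℝ) 1 zero_le_one (f a / C) :=
      (continuous_projIcc.comp (f.continuous.div_const C)).measurable
    refine Measure.measurable_of_measurable_coe _ fun s hs => ?_
    simp only [bernoulliMeasure_def, Measure.add_apply, Measure.smul_apply]
    have h' : Measurable unitInterval.toNNReal :=
      measurable_subtype_coe.subtype_mk
    exact ((h'.comp h).coe_nnreal_ennreal.mul_const _).add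
      ((h'.comp (unitInterval.continuous_symm.measurable.comp h)).coe_nnreal_ennreal.mul_const _)

instance (C : ℝ) (f : C(unitInterval, ℝ)) : IsMarkovKernel (bernoulliReward C f) :=
  ⟨fun a => inferInstanceAs
    (IsProbabilityMeasure (bernoulliMeasure C 0 (projIcc 0 1 zero_le_one (f a / C))))⟩

/-- The reward of action `a` drawn from `ρ a` has mean `f a`, and the noise `R - f a` is
`(σ², b)`-sub-exponential. -/
def IsSubExponentialReward (ρ : Kernel unitInterval ℝ) (f : C(unitInterval, ℝ)) (σ b : ℝ) : Prop :=
  ∀ a, Integrable id (ρ a) ∧ ∫ r, r ∂(ρ a) = f a ∧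
    ∀ s : ℝ, |s| ≤ 1 / b → Integrable (fun r => Real.exp (s * (r - f a))) (ρ a) ∧
      ∫ r, Real.exp (s * (r - f a)) ∂(ρ a) ≤ Real.exp (s ^ 2 * σ ^ 2 / 2)

/-! ### Algorithms, histories and regret -/

/-- A (possibly randomised) algorithm for the bandit with actions in `[0,1]`: after `t` rounds, the
distribution of the next action is a measurable function of the `t` actions and rewards so far. -/
structure Algorithm where
  /-- the conditional distribution of the next action given the history -/
  next : (t : ℕ) → Kernel (Fin t → unitInterval × ℝ) unitInterval
  /-- these are probability distributions -/
  markov : ∀ t, IsMarkovKernel (next t)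

/-- The law of the first `t` pairs (action, reward) when `ALG` plays and the reward of an action `a`
is drawn from `ρ a`, conditionally independently of the past given `a`. -/
noncomputable def historyLaw (ALG : Algorithm) (ρ : Kernel unitInterval ℝ) :
    (t : ℕ) → Measure (Fin t → unitInterval × ℝ)
  | 0 => Measure.dirac Fin.elim0
  | t + 1 => ((historyLaw ALG ρ t) ⊗ₘ
      ((ALG.next t) ⊗ₖ (Kernel.prodMkLeft (Fin t → unitInterval × ℝ) ρ))).map
        fun p => (Fin.snoc p.1 p.2 : Fin (t + 1) → unitInterval × ℝ)

/-- The expected regret `T max_a f(a) - E ∑_{t ≤ T} f(a_t)` of `ALG` after `T` rounds, in the problem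
instance with reward function `f` and reward distributions `ρ`. -/
noncomputable def expectedRegret (ALG : Algorithm) (f : C(unitInterval, ℝ))
    (ρ : Kernel unitInterval ℝ) (T : ℕ) : ℝ :=
  T * (⨆ a, f a) - ∫ h, ∑ t : Fin T, f (h t).1 ∂(historyLaw ALG ρ T)

/-!
A bump of support radius `r` in the smoothness class can be as high as a constant times
`r ^ (M + 1)`, and about `1 / (2 r)` such bumps fit side by side into `[0, 1]`. An algorithm facing
constant rewards `C / 2` plays at most `2 r T`, up to a constant, of its rounds in the support of
one of them, in expectation. In the presence of that bump, of height `δ`, each of these rounds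
reveals an amount of information of order `δ²`. If `r T δ²` is small, the algorithm therefore
behaves much the same in the two cases, and misses the bump in at least half of the rounds, at a
cost of `δ` each. With `r = σ T ^ (-1 / (2 M + 3))`, up to a factor, `r T δ²` is bounded by a small
constant and the regret is at least `δ T / 2`, of order `T ^ ((M + 2) / (2 M + 3))`.

The bumps are rescaled perfect splines (`bumpSpline`), obtained from the tent function by repeated
averaging over intervals; `bumpReward.isBump` and `bumpReward.mem_smoothRewards` give their
properties. The constant `w` is the support radius `2 ^ M` of `bumpSpline M` divided by the
`(M + 1)`-th root of its height. The law of the history under a bump has an explicit density with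
respect to the law under constant rewards (`historyLaw_eq_withDensity`). The comparison of the two
laws, `integral_visits_le`, combines the bound on the relative entropy with the elementary
inequality `mul_le_two_mul_add_log` in the place of Pinsker's inequality.
`exists_bumpReward_regret` is the resulting regret bound for a given width.
-/

/-! ### Spline bumps -/

/-- The unscaled bump: the tent `max 0 (1 - |x|)`, convolved `n` times with the indicators of
`[-2 ^ k, 2 ^ k]`, `k < n`. It is a `C^n` even bump on `[-2 ^ n, 2 ^ n]`. Doubling the width in
each step makes the two translates in its derivative
`bumpSpline n (x + 2 ^ n) - bumpSpline n (x - 2 ^ n)` have disjoint supports, so that the next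
derivative takes no values other than `-1, 0, 1`. -/
noncomputable def bumpSpline : ℕ → ℝ → ℝ
  | 0 => fun x => max 0 (1 - |x|)
  | n + 1 => fun x => ∫ t in (x - 2 ^ n)..(x + 2 ^ n), bumpSpline n t

namespace bumpSpline

lemma hasDerivAt_succ_of_continuous {n : ℕ} (h : Continuous (bumpSpline n)) (x : ℝ) :
    HasDerivAt (bumpSpline (n + 1)) (bumpSpline n (x + 2 ^ n) - bumpSpline n (x - 2 ^ n)) x := by
  have key : bumpSpline (n + 1) = fun x =>
      (∫ t in (0 : ℝ)..(x + 2 ^ n), bumpSpline n t) -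
        ∫ t in (0 : ℝ)..(x - 2 ^ n), bumpSpline n t := by
    funext y
    rw [intervalIntegral.integral_interval_sub_left] <;>
      first | exact h.intervalIntegrable _ _ | rfl
  have hF (y : ℝ) : HasDerivAt (fun z => ∫ t in (0 : ℝ)..z, bumpSpline n t) (bumpSpline n y) y :=
    intervalIntegral.integral_hasDerivAt_right (h.intervalIntegrable _ _)
      (h.stronglyMeasurableAtFilter _ _) h.continuousAt
  rw [key]
  exact ((hF _).comp_add_const x (2 ^ n)).sub ((hF _).comp_sub_const x (2 ^ n))

lemma continuous : ∀ n : ℕ, Continuous (bumpSpline n)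
  | 0 => by unfold bumpSpline; fun_prop
  | n + 1 => continuous_iff_continuousAt.2 fun x =>
      (hasDerivAt_succ_of_continuous (continuous n) x).continuousAt

lemma hasDerivAt_succ (n : ℕ) (x : ℝ) :
    HasDerivAt (bumpSpline (n + 1)) (bumpSpline n (x + 2 ^ n) - bumpSpline n (x - 2 ^ n)) x :=
  hasDerivAt_succ_of_continuous (continuous n) x

lemma deriv_succ (n : ℕ) :
    deriv (bumpSpline (n + 1)) = fun x => bumpSpline n (x + 2 ^ n) - bumpSpline n (x - 2 ^ n) :=
  funext fun x => (hasDerivAt_succ n x).deriv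

lemma comp_neg (n : ℕ) (x : ℝ) : bumpSpline n (-x) = bumpSpline n x := by
  induction n generalizing x with
  | zero => simp [bumpSpline]
  | succ n ih =>
    have h := intervalIntegral.integral_comp_neg (a := x - 2 ^ n) (b := x + 2 ^ n) (bumpSpline n)
    simp only [ih] at h
    simp only [bumpSpline]
    rw [h]
    congr 1 <;> ring

lemma comp_abs (n : ℕ) (x : ℝ) : bumpSpline n |x| = bumpSpline n x := by
  rcases abs_choice x with h | h <;> rw [h]
  exact comp_neg n x

lemma nonneg (n : ℕ) (x : ℝ) : 0 ≤ bumpSpline n x := by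
  induction n generalizing x with
  | zero => exact le_max_left _ _
  | succ n ih =>
    refine intervalIntegral.integral_nonneg ?_ fun u _ => ih u
    have : (0 : ℝ) < 2 ^ n := by positivity
    linarith

lemma pos {n : ℕ} {x : ℝ} (hx : |x| < 2 ^ n) : 0 < bumpSpline n x := by
  induction n generalizing x with
  | zero =>
    have : |x| < 1 := by simpa using hx
    exact lt_max_of_lt_right (by linarith)
  | succ n ih =>
    have h2 : (0 : ℝ) < 2 ^ n := by positivity
    rw [pow_succ, abs_lt] at hx
    refine intervalIntegral.integral_pos (by linarith) (continuous n).continuousOn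
      (fun u _ => nonneg n u) ⟨x / 2, ⟨by linarith, by linarith⟩, ih ?_⟩
    rw [abs_lt]
    constructor <;> linarith

lemma eq_zero {n : ℕ} {x : ℝ} (hx : 2 ^ n ≤ |x|) : bumpSpline n x = 0 := by
  induction n generalizing x with
  | zero =>
    have : 1 ≤ |x| := by simpa using hx
    exact max_eq_left (by linarith)
  | succ n ih =>
    have h2 : (0 : ℝ) < 2 ^ n := by positivity
    rw [pow_succ, le_abs] at hx
    have : ∀ t ∈ uIcc (x - 2 ^ n) (x + 2 ^ n), bumpSpline n t = 0 := by
      intro t ht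
      rw [uIcc_of_le (by linarith)] at ht
      apply ih
      rw [le_abs]
      rcases hx with hx | hx
      · left; linarith [ht.1]
      · right; linarith [ht.2]
    simp only [bumpSpline]
    rw [intervalIntegral.integral_congr this]
    simp

lemma antitoneOn (n : ℕ) : AntitoneOn (bumpSpline n) (Ici 0) := by
  induction n with
  | zero =>
    intro x hx y hy hxy
    simp only [bumpSpline, abs_of_nonneg (mem_Ici.1 hx), abs_of_nonneg (mem_Ici.1 hy)]
    gcongr
  | succ n ih =>
    refine antitoneOn_of_deriv_nonpos (convex_Ici 0) (continuous _).continuousOn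
      (fun x _ => (hasDerivAt_succ n x).differentiableAt.differentiableWithinAt) fun x hx => ?_
    rw [interior_Ici, mem_Ioi] at hx
    have h2 : (0 : ℝ) < 2 ^ n := by positivity
    rw [(hasDerivAt_succ n x).deriv, sub_nonpos, ← comp_abs n (x + 2 ^ n), ← comp_abs n (x - 2 ^ n)]
    refine ih (mem_Ici.2 (abs_nonneg _)) (mem_Ici.2 (abs_nonneg _)) ?_
    rw [abs_of_pos (by linarith : 0 < x + 2 ^ n), abs_le]
    constructor <;> linarith

lemma le_of_abs_le {n : ℕ} {x y : ℝ} (h : |x| ≤ |y|) : bumpSpline n y ≤ bumpSpline n x := by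
  rw [← comp_abs n x, ← comp_abs n y]
  exact antitoneOn n (mem_Ici.2 (abs_nonneg x)) (mem_Ici.2 (abs_nonneg y)) h

lemma le_zero_apply (n : ℕ) (x : ℝ) : bumpSpline n x ≤ bumpSpline n 0 :=
  le_of_abs_le (by simp)

lemma zero_apply_pos (n : ℕ) : 0 < bumpSpline n 0 := pos (by simp)

lemma contDiff (n : ℕ) : ContDiff ℝ n (bumpSpline n) := by
  induction n with
  | zero => exact contDiff_zero.2 (continuous 0)
  | succ n ih =>
    push_cast
    refine contDiff_succ_iff_deriv.2
      ⟨fun x => (hasDerivAt_succ n x).differentiableAt, by simp, ?_⟩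
    rw [deriv_succ]
    exact (ih.comp (contDiff_id.add contDiff_const)).sub (ih.comp (contDiff_id.sub contDiff_const))

lemma iteratedDeriv_succ_succ {m n : ℕ} (hm : m ≤ n) (x : ℝ) :
    iteratedDeriv (m + 1) (bumpSpline (n + 1)) x =
      iteratedDeriv m (bumpSpline n) (x + 2 ^ n) - iteratedDeriv m (bumpSpline n) (x - 2 ^ n) := by
  have h : ContDiff ℝ m (bumpSpline n) := (contDiff n).of_le (by exact_mod_cast hm)
  rw [iteratedDeriv_succ', deriv_succ]
  have := iteratedDeriv_sub (x := x) (n := m) (f := fun x => bumpSpline n (x + 2 ^ n))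
    (g := fun x => bumpSpline n (x - 2 ^ n))
    (h.comp (contDiff_id.add contDiff_const)).contDiffAt
    (h.comp (contDiff_id.sub contDiff_const)).contDiffAt
  rw [iteratedDeriv_comp_add_const, iteratedDeriv_comp_sub_const] at this
  exact this

lemma iteratedDeriv_eq_zero {n : ℕ} {x : ℝ} (hx : 2 ^ n ≤ |x|) :
    iteratedDeriv n (bumpSpline n) x = 0 := by
  induction n generalizing x with
  | zero => simpa using eq_zero hx
  | succ n ih =>
    rw [iteratedDeriv_succ_succ le_rfl, ih, ih, sub_zero] <;>
    · rw [pow_succ, le_abs] at hx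
      have h2 : (0 : ℝ) < 2 ^ n := by positivity
      rw [le_abs]
      rcases hx with hx | hx
      · left; linarith
      · right; linarith

/-- The top derivative is `1`-Lipschitz, and not merely `2 ^ n`-Lipschitz: on each side of `0` only
one of the two translates in `iteratedDeriv_succ_succ` is nonzero. -/
lemma abs_iteratedDeriv_sub_le (n : ℕ) (x y : ℝ) :
    |iteratedDeriv n (bumpSpline n) x - iteratedDeriv n (bumpSpline n) y| ≤ |x - y| := by
  induction n generalizing x y with
  | zero =>
    simp only [iteratedDeriv_zero, bumpSpline]
    refine (abs_max_sub_max_le_max _ _ _ _).trans ?_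
    rw [sub_self, abs_zero, max_eq_right (abs_nonneg _), sub_sub_sub_cancel_left, abs_sub_comm x y]
    exact abs_abs_sub_abs_le y x
  | succ n ih =>
    have h2 : (0 : ℝ) < 2 ^ n := by positivity
    have left (x y : ℝ) (hx : x ≤ 0) (hy : y ≤ 0) :
        |iteratedDeriv (n + 1) (bumpSpline (n + 1)) x -
          iteratedDeriv (n + 1) (bumpSpline (n + 1)) y| ≤ |x - y| := by
      rw [iteratedDeriv_succ_succ le_rfl, iteratedDeriv_succ_succ le_rfl,
        iteratedDeriv_eq_zero (x := x - 2 ^ n) (le_abs.2 (Or.inr (by linarith))),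
        iteratedDeriv_eq_zero (x := y - 2 ^ n) (le_abs.2 (Or.inr (by linarith)))]
      simpa using ih (x + 2 ^ n) (y + 2 ^ n)
    have right (x y : ℝ) (hx : 0 ≤ x) (hy : 0 ≤ y) :
        |iteratedDeriv (n + 1) (bumpSpline (n + 1)) x -
          iteratedDeriv (n + 1) (bumpSpline (n + 1)) y| ≤ |x - y| := by
      rw [iteratedDeriv_succ_succ le_rfl, iteratedDeriv_succ_succ le_rfl,
        iteratedDeriv_eq_zero (x := x + 2 ^ n) (le_abs.2 (Or.inl (by linarith))),
        iteratedDeriv_eq_zero (x := y + 2 ^ n) (le_abs.2 (Or.inl (by linarith)))]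
      have := ih (y - 2 ^ n) (x - 2 ^ n)
      rw [sub_sub_sub_cancel_right, abs_sub_comm y x] at this
      rwa [zero_sub, zero_sub, neg_sub_neg]
    rcases le_total x 0 with hx | hx <;> rcases le_total y 0 with hy | hy
    · exact left x y hx hy
    · refine (abs_sub_le _ (iteratedDeriv (n + 1) (bumpSpline (n + 1)) 0) _).trans
        ((add_le_add (left x 0 hx le_rfl) (right 0 y le_rfl hy)).trans_eq ?_)
      rw [abs_of_nonpos, abs_of_nonpos, abs_of_nonpos] <;> linarith
    · refine (abs_sub_le _ (iteratedDeriv (n + 1) (bumpSpline (n + 1)) 0) _).trans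
        ((add_le_add (right x 0 hx le_rfl) (left 0 y le_rfl hy)).trans_eq ?_)
      rw [abs_of_nonneg, abs_of_nonneg, abs_of_nonneg] <;> linarith
    · exact right x y hx hy

/-- Off the knots, the `(n + 1)`-th derivative exists and is `-1`, `0` or `1`. The knots of
`bumpSpline (n + 1)` are the translates of those of `bumpSpline n`, and `0`, where the two
translates meet. -/
lemma exists_hasDerivAt_iteratedDeriv (n : ℕ) : ∃ S : Set ℝ, S.Finite ∧ ∀ x ∉ S,
    ∃ d ∈ ({-1, 0, 1} : Set ℝ), HasDerivAt (iteratedDeriv n (bumpSpline n)) d x := by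
  induction n with
  | zero =>
    refine ⟨{-1, 0, 1}, by simp, fun x hx => ?_⟩
    simp only [mem_insert_iff, mem_singleton_iff, not_or] at hx
    obtain ⟨h1, h2, h3⟩ := hx
    simp only [iteratedDeriv_zero]
    rcases lt_or_gt_of_ne h1 with h1 | h1
    · refine ⟨0, by simp, (hasDerivAt_const x (0 : ℝ)).congr_of_eventuallyEq ?_⟩
      filter_upwards [Iio_mem_nhds h1] with y hy
      exact eq_zero (le_abs.2 (Or.inr (by simp only [mem_Iio] at hy; norm_num; linarith)))
    rcases lt_or_gt_of_ne h2 with h2 | h2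
    · refine ⟨1, by simp, ((hasDerivAt_id x).const_add (1 : ℝ)).congr_of_eventuallyEq ?_⟩
      filter_upwards [Ioo_mem_nhds h1 h2] with y hy
      simp only [bumpSpline, abs_of_neg hy.2, id]
      rw [max_eq_right] <;> linarith [hy.1]
    rcases lt_or_gt_of_ne h3 with h3 | h3
    · refine ⟨-1, by simp, ((hasDerivAt_id x).const_sub (1 : ℝ)).congr_of_eventuallyEq ?_⟩
      filter_upwards [Ioo_mem_nhds h2 h3] with y hy
      simp only [bumpSpline, abs_of_pos hy.1, id]
      rw [max_eq_right]; linarith [hy.2]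
    · refine ⟨0, by simp, (hasDerivAt_const x (0 : ℝ)).congr_of_eventuallyEq ?_⟩
      filter_upwards [Ioi_mem_nhds h3] with y hy
      exact eq_zero (le_abs.2 (Or.inl (by simp only [mem_Ioi] at hy; norm_num; linarith)))
  | succ n ih =>
    obtain ⟨S, hS, h⟩ := ih
    have h2 : (0 : ℝ) < 2 ^ n := by positivity
    refine ⟨{0} ∪ ((fun x => x - 2 ^ n) '' S ∪ (fun x => x + 2 ^ n) '' S),
      (finite_singleton 0).union ((hS.image _).union (hS.image _)), fun x hx => ?_⟩
    simp only [mem_union, mem_singleton_iff, mem_image, not_or, not_exists, not_and] at hx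
    obtain ⟨hx0, hx1, hx2⟩ := hx
    rcases lt_or_gt_of_ne hx0 with hx0 | hx0
    · obtain ⟨d, hd, hd'⟩ := h (x + 2 ^ n) fun hmem => hx1 _ hmem (by ring)
      refine ⟨d, hd, (hd'.comp_add_const x (2 ^ n)).congr_of_eventuallyEq ?_⟩
      filter_upwards [Iio_mem_nhds hx0] with y hy
      rw [iteratedDeriv_succ_succ le_rfl, sub_eq_self]
      exact iteratedDeriv_eq_zero (le_abs.2 (Or.inr (by linarith [mem_Iio.1 hy])))
    · obtain ⟨d, hd, hd'⟩ := h (x - 2 ^ n) fun hmem => hx2 _ hmem (by ring)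
      refine ⟨-d, ?_, (hd'.comp_sub_const x (2 ^ n)).neg.congr_of_eventuallyEq ?_⟩
      · simp only [mem_insert_iff, mem_singleton_iff] at hd ⊢
        rcases hd with rfl | rfl | rfl <;> simp
      filter_upwards [Ioi_mem_nhds hx0] with y hy
      rw [iteratedDeriv_succ_succ le_rfl, Pi.neg_apply, sub_eq_neg_self]
      exact iteratedDeriv_eq_zero (le_abs.2 (Or.inl (by linarith [mem_Ioi.1 hy])))

/-- The derivatives below the top one are Lipschitz with a constant that may be large; it is
absorbed by rescaling. -/
lemma exists_lipschitz (n : ℕ) : ∃ K : ℝ, 1 ≤ K ∧ ∀ m ≤ n, ∀ x y : ℝ,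
    |iteratedDeriv m (bumpSpline n) x - iteratedDeriv m (bumpSpline n) y| ≤ K * |x - y| := by
  induction n with
  | zero =>
    refine ⟨1, le_rfl, fun m hm x y => ?_⟩
    obtain rfl : m = 0 := by omega
    simpa using abs_iteratedDeriv_sub_le 0 x y
  | succ n ih =>
    obtain ⟨K, hK, h⟩ := ih
    refine ⟨max (2 * K) (bumpSpline n 0), le_max_of_le_left (by linarith), fun m hm x y => ?_⟩
    rcases m with _ | m
    · refine le_trans ?_ (mul_le_mul_of_nonneg_right (le_max_right _ _) (abs_nonneg _))
      simp only [iteratedDeriv_zero]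
      refine Convex.norm_image_sub_le_of_norm_hasDerivWithin_le (s := univ)
        (fun z _ => (hasDerivAt_succ n z).hasDerivWithinAt) (fun z _ => ?_) convex_univ
        (mem_univ y) (mem_univ x)
      rw [Real.norm_eq_abs, abs_le]
      constructor <;> linarith [nonneg n (z + 2 ^ n), nonneg n (z - 2 ^ n),
        le_zero_apply n (z + 2 ^ n), le_zero_apply n (z - 2 ^ n)]
    · refine le_trans ?_ (mul_le_mul_of_nonneg_right (le_max_left _ _) (abs_nonneg _))
      have hm' : m ≤ n := by omega
      rw [iteratedDeriv_succ_succ hm', iteratedDeriv_succ_succ hm']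
      have h1 := h m hm' (x + 2 ^ n) (y + 2 ^ n)
      have h2 := h m hm' (x - 2 ^ n) (y - 2 ^ n)
      rw [add_sub_add_right_eq_sub] at h1
      rw [sub_sub_sub_cancel_right] at h2
      rw [sub_sub_sub_comm]
      exact (abs_sub _ _).trans (by linarith)

end bumpSpline

/-! ### Bump reward functions -/

/-- The bump of width parameter `s` at `c` above the base line `C / 2`, as a function on the line.
The factor `s ^ (M + 1)` compensates the `M + 1` derivatives, so that the `(M + 1)`-th derivative
is `L` times that of `bumpSpline M`. -/
noncomputable def bumpFun (C : ℝ) (M : ℕ) (L c s y : ℝ) : ℝ :=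
  C / 2 + L * s ^ (M + 1) * bumpSpline M (s⁻¹ * (y - c))

/-- The restriction of `bumpFun` to `[0, 1]`, a reward function. It need not vanish at the end
points of `[0, 1]`. -/
noncomputable def bumpReward (C : ℝ) (M : ℕ) (L : ℝ) (c : unitInterval) (s : ℝ) :
    C(unitInterval, ℝ) where
  toFun a := bumpFun C M L c s a
  continuous_toFun := by
    have := bumpSpline.continuous M
    unfold bumpFun
    fun_prop

namespace bumpReward

variable {C : ℝ} {M : ℕ} {L : ℝ} {s : ℝ}

lemma contDiff_bumpFun (C : ℝ) (M : ℕ) (L c s : ℝ) : ContDiff ℝ M (bumpFun C M L c s) := by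
  have := bumpSpline.contDiff M
  unfold bumpFun
  fun_prop

lemma iteratedDeriv_bumpFun (C L c s : ℝ) {m : ℕ} (hm : m ≤ M) (y : ℝ) :
    iteratedDeriv m (bumpFun C M L c s) y = (if m = 0 then C / 2 else 0) +
      L * s ^ (M + 1) * (s⁻¹ ^ m * iteratedDeriv m (bumpSpline M) (s⁻¹ * (y - c))) := by
  have h : ContDiff ℝ m (bumpSpline M) :=
    (bumpSpline.contDiff M).of_le (by exact_mod_cast hm)
  have key : iteratedDeriv m (fun y => L * s ^ (M + 1) * bumpSpline M (s⁻¹ * (y - c))) y =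
      L * s ^ (M + 1) * (s⁻¹ ^ m * iteratedDeriv m (bumpSpline M) (s⁻¹ * (y - c))) := by
    rw [iteratedDeriv_const_mul_field]
    have := iteratedDeriv_comp_sub_const m (fun z => bumpSpline M (s⁻¹ * z)) c
    rw [this, iteratedDeriv_comp_const_mul h]
  rcases Nat.eq_zero_or_pos m with rfl | hm0
  · simp [bumpFun]
  · rw [if_neg hm0.ne', zero_add, ← key]
    exact iteratedDeriv_const_add hm0 _

lemma extend_eq (C : ℝ) (M : ℕ) (L : ℝ) (c : unitInterval) (s : ℝ) :
    EqOn (IccExtend zero_le_one (bumpReward C M L c s)) (bumpFun C M L c s) (Icc 0 1) :=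
  fun x hx => by rw [IccExtend_of_mem _ _ hx]; rfl

lemma iteratedDerivWithin_eq (C L : ℝ) (c : unitInterval) (s : ℝ) {m : ℕ} (hm : m ≤ M) {a : ℝ}
    (ha : a ∈ Icc (0 : ℝ) 1) :
    iteratedDerivWithin m (IccExtend zero_le_one (bumpReward C M L c s)) (Icc 0 1) a =
      iteratedDeriv m (bumpFun C M L c s) a := by
  rw [iteratedDerivWithin_congr (extend_eq C M L c s) ha]
  exact iteratedDerivWithin_eq_iteratedDeriv (uniqueDiffOn_Icc zero_lt_one)
    ((contDiff_bumpFun C M L c s).of_le (by exact_mod_cast hm)).contDiffAt ha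

lemma apply_eq (c a : unitInterval) : bumpReward C M L c s a =
    C / 2 + L * s ^ (M + 1) * bumpSpline M (s⁻¹ * ((a : ℝ) - c)) := rfl

lemma mem_Icc_height (hL : 0 < L) (hs : 0 < s) (c a : unitInterval) :
    bumpReward C M L c s a ∈ Icc (C / 2) (C / 2 + L * s ^ (M + 1) * bumpSpline M 0) := by
  rw [apply_eq]
  have h0 := bumpSpline.nonneg M (s⁻¹ * ((a : ℝ) - c))
  have h1 := bumpSpline.le_zero_apply M (s⁻¹ * ((a : ℝ) - c))
  refine ⟨le_add_of_nonneg_right (by positivity), ?_⟩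
  gcongr

lemma abs_arg (hs : 0 < s) (t : ℝ) : |s⁻¹ * t| = |t| / s := by
  rw [abs_mul, abs_of_pos (inv_pos.2 hs), div_eq_inv_mul]

lemma apply_anti (hL : 0 < L) (hs : 0 < s) {c a b : unitInterval}
    (h : |(a : ℝ) - c| ≤ |(b : ℝ) - c|) : bumpReward C M L c s b ≤ bumpReward C M L c s a := by
  rw [apply_eq, apply_eq]
  have : bumpSpline M (s⁻¹ * ((b : ℝ) - c)) ≤ bumpSpline M (s⁻¹ * ((a : ℝ) - c)) := by
    apply bumpSpline.le_of_abs_le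
    rw [abs_arg hs, abs_arg hs]
    gcongr
  gcongr

lemma apply_eq_base (hs : 0 < s) {c a : unitInterval} (h : 2 ^ M * s ≤ |(a : ℝ) - c|) :
    bumpReward C M L c s a = C / 2 := by
  rw [apply_eq, bumpSpline.eq_zero (by rwa [abs_arg hs, le_div_iff₀ hs]), mul_zero, add_zero]

/-- The scaled spline is a bump in the sense of `IsBump`, of height `L s ^ (M + 1) bumpSpline M 0`
and support radius `2 ^ M s`. -/
theorem isBump (hL : 0 < L) (hs : 0 < s) (c : unitInterval) :
    IsBump C M L c (L * s ^ (M + 1) * bumpSpline M 0) (2 ^ M * s) (bumpReward C M L c s) where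
  mem_Icc := mem_Icc_height hL hs c
  apply_center := by simp [apply_eq]
  symmetric a a' h := le_antisymm (apply_anti hL hs h.ge) (apply_anti hL hs h.le)
  monotone_left a ha b hb hab := by
    refine apply_anti hL hs ?_
    have h1 : (a : ℝ) ≤ b := hab
    have h2 : (b : ℝ) ≤ c := hb
    rw [abs_of_nonpos, abs_of_nonpos] <;> linarith
  antitone_right a ha b hb hab := by
    refine apply_anti hL hs ?_
    have h1 : (a : ℝ) ≤ b := hab
    have h2 : (c : ℝ) ≤ a := ha
    rw [abs_of_nonneg, abs_of_nonneg] <;> linarith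
  above a ha := by
    have : 0 < bumpSpline M (s⁻¹ * ((a : ℝ) - c)) := by
      apply bumpSpline.pos
      rwa [abs_arg hs, div_lt_iff₀ hs]
    rw [apply_eq]
    exact lt_add_of_pos_right _ (by positivity)
  base a ha := apply_eq_base hs ha
  piecewise := by
    obtain ⟨S, hS, h⟩ := bumpSpline.exists_hasDerivAt_iteratedDeriv M
    refine ⟨(fun z => s * z + c) '' S, hS.image _, fun a ha => ?_⟩
    obtain ⟨⟨ha0, ha1⟩, haS⟩ := ha
    obtain ⟨d, hd, hd'⟩ := h (s⁻¹ * (a - c)) fun hmem =>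
      haS ⟨_, hmem, by simp only; field_simp; ring⟩
    refine ⟨L * d, ?_, ?_⟩
    · simp only [mem_insert_iff, mem_singleton_iff] at hd ⊢
      rcases hd with rfl | rfl | rfl <;> simp
    have hin : HasDerivAt (fun y : ℝ => s⁻¹ * (y - c)) s⁻¹ a := by
      simpa using ((hasDerivAt_id a).sub_const (c : ℝ)).const_mul s⁻¹
    have hcomp := (((hd'.comp a hin).const_mul (s⁻¹ ^ M)).const_mul (L * s ^ (M + 1))).const_add
      (if M = 0 then C / 2 else 0)
    have hval : L * s ^ (M + 1) * (s⁻¹ ^ M * (d * s⁻¹)) = L * d := by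
      rw [inv_pow]; field_simp; ring
    rw [hval] at hcomp
    refine hcomp.congr_of_eventuallyEq ?_
    filter_upwards [Icc_mem_nhds ha0 ha1] with y hy
    rw [iteratedDerivWithin_eq C L c s le_rfl hy, iteratedDeriv_bumpFun C L c s le_rfl]
    rfl
  tent hM a := by
    subst hM
    have h1 : bumpSpline 0 0 = 1 := by simp [bumpSpline]
    have h2 : bumpSpline 0 (s⁻¹ * ((a : ℝ) - c)) = max 0 (1 - |(a : ℝ) - c| / s) := by
      rw [← abs_arg hs]; rfl
    rw [apply_eq, h1, h2, mul_max_of_nonneg _ _ (by positivity), ← max_add_add_left]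
    congr 1
    · simp
    · field_simp
      ring

/-- For small `s` the bump lies in the smoothness class: the `m`-th derivative has Lipschitz
constant `L s ^ (M - m)` times that of the `m`-th derivative of `bumpSpline M`, which is `1` for
`m = M` and at most `K ≤ 1 / s` for `m < M`. -/
theorem mem_smoothRewards (hC : 0 < C) (hL : 0 < L) (hs : 0 < s) (hs1 : s ≤ 1) {K : ℝ}
    (hK0 : 0 ≤ K)
    (hK : ∀ m ≤ M, ∀ x y : ℝ, |iteratedDeriv m (bumpSpline M) x - iteratedDeriv m (bumpSpline M) y|
      ≤ K * |x - y|) (hsK : s * K ≤ 1) (hδ : L * s ^ (M + 1) * bumpSpline M 0 ≤ C / 2)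
    (c : unitInterval) : bumpReward C M L c s ∈ smoothRewards C M L := by
  refine ⟨fun a => ?_, ?_, fun m hm a ha a' ha' => ?_⟩
  · have := mem_Icc_height (C := C) (M := M) hL hs c a
    exact ⟨by linarith [this.1], by linarith [this.2]⟩
  · exact (contDiff_bumpFun C M L c s).contDiffOn.congr fun x hx => extend_eq C M L c s hx
  rw [iteratedDerivWithin_eq C L c s hm ha, iteratedDerivWithin_eq C L c s hm ha',
    iteratedDeriv_bumpFun C L c s hm, iteratedDeriv_bumpFun C L c s hm, add_sub_add_left_eq_sub,
    ← mul_sub, ← mul_sub, abs_mul (L * s ^ (M + 1)), abs_mul (s⁻¹ ^ m),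
    abs_of_pos (by positivity : 0 < L * s ^ (M + 1)),
    abs_of_pos (by positivity : 0 < s⁻¹ ^ m), mul_assoc]
  have harg : |s⁻¹ * (a - c) - s⁻¹ * (a' - c)| = |a - a'| / s := by
    rw [← mul_sub, abs_arg hs, sub_sub_sub_cancel_right]
  gcongr
  rcases hm.lt_or_eq with hlt | rfl
  · have h1 := hK m hm (s⁻¹ * (a - c)) (s⁻¹ * (a' - c))
    rw [harg] at h1
    calc s ^ (M + 1) * (s⁻¹ ^ m * _) ≤ s ^ (M + 1) * (s⁻¹ ^ m * (K * (|a - a'| / s))) := by gcongr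
      _ = s ^ (M - m - 1) * ((s * K) * |a - a'|) := by
        obtain ⟨k, rfl⟩ := Nat.exists_eq_add_of_lt hlt
        rw [show m + k + 1 - m - 1 = k by omega, inv_pow]
        field_simp
        ring
      _ ≤ 1 * (1 * |a - a'|) := by
        have := pow_le_one₀ (n := M - m - 1) hs.le hs1
        gcongr
      _ = |a - a'| := by ring
  · have h1 := bumpSpline.abs_iteratedDeriv_sub_le m (s⁻¹ * (a - c)) (s⁻¹ * (a' - c))
    rw [harg] at h1
    calc s ^ (m + 1) * (s⁻¹ ^ m * _) ≤ s ^ (m + 1) * (s⁻¹ ^ m * (|a - a'| / s)) := by gcongr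
      _ = |a - a'| := by rw [inv_pow]; field_simp; ring

end bumpReward

/-- The noise of a scaled Bernoulli reward is sub-Gaussian with variance proxy `C² / 4`, by
Hoeffding's lemma; so the bound holds for every `s`, not only for `|s| ≤ 1 / b`. -/
theorem isSubExponentialReward_bernoulliReward {C : ℝ} (hC : 0 < C) {f : C(unitInterval, ℝ)}
    (hf : ∀ a, f a ∈ Icc 0 C) (b : ℝ) :
    IsSubExponentialReward (bernoulliReward C f) f (C / 2) b := by
  intro a
  have hdef : bernoulliReward C f a =
      bernoulliMeasure C 0 (projIcc 0 1 zero_le_one (f a / C)) := rfl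
  have hp : f a / C ∈ Icc (0 : ℝ) 1 :=
    ⟨div_nonneg (hf a).1 hC.le, (div_le_one hC).2 (hf a).2⟩
  have hmean : ∫ r, r ∂(bernoulliReward C f a) = f a := by
    rw [hdef, integral_bernoulliMeasure, projIcc_of_mem _ hp]
    simp [hC.ne']
  refine ⟨integrable_bernoulliMeasure _ _ _ _, hmean,
    fun t _ => ⟨integrable_bernoulliMeasure _ _ _ _, ?_⟩⟩
  have hb : ∀ᵐ r ∂(bernoulliReward C f a), id r ∈ Icc 0 C := by
    rw [hdef, bernoulliMeasure_def, ae_add_measure_iff]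
    exact ⟨Measure.ae_smul_measure (by rw [ae_dirac_eq]; exact ⟨hC.le, le_rfl⟩) _,
      Measure.ae_smul_measure (by rw [ae_dirac_eq]; exact ⟨le_rfl, hC.le⟩) _⟩
  have h := (hasSubgaussianMGF_of_mem_Icc aemeasurable_id hb).mgf_le t
  simp only [mgf, id, hmean] at h
  refine h.trans_eq ?_
  congr 1
  simp only [sub_zero, NNReal.coe_pow, NNReal.coe_div, coe_nnnorm, Real.norm_eq_abs, abs_of_pos hC,
    NNReal.coe_ofNat]
  ring

/-! ### Histories and change of measure -/

open scoped ENNReal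

instance (ALG : Algorithm) (t : ℕ) : IsMarkovKernel (ALG.next t) := ALG.markov t

lemma measurable_fin_snoc {α : Type*} [MeasurableSpace α] (t : ℕ) :
    Measurable fun p : (Fin t → α) × α => (Fin.snoc p.1 p.2 : Fin (t + 1) → α) := by
  refine measurable_pi_iff.2 fun i => ?_
  induction i using Fin.lastCases with
  | last => simpa using measurable_snd
  | cast i => simpa [Function.comp_def] using (measurable_pi_apply i).comp measurable_fst

instance isProbabilityMeasure_historyLaw (ALG : Algorithm) (ρ : Kernel unitInterval ℝ)
    [IsMarkovKernel ρ] (t : ℕ) : IsProbabilityMeasure (historyLaw ALG ρ t) := by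
  induction t with
  | zero => exact Measure.dirac.isProbabilityMeasure
  | succ t ih => exact Measure.isProbabilityMeasure_map (measurable_fin_snoc t).aemeasurable

lemma lintegral_historyLaw_succ (ALG : Algorithm) (ρ : Kernel unitInterval ℝ) [IsMarkovKernel ρ]
    (t : ℕ) {F : (Fin (t + 1) → unitInterval × ℝ) → ℝ≥0∞} (hF : Measurable F) :
    ∫⁻ h, F h ∂(historyLaw ALG ρ (t + 1)) =
      ∫⁻ h, ∫⁻ a, ∫⁻ r, F (Fin.snoc h (a, r)) ∂(ρ a) ∂(ALG.next t h) ∂(historyLaw ALG ρ t) := by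
  have hm : Measurable fun p : (Fin t → unitInterval × ℝ) × (unitInterval × ℝ) =>
      F (Fin.snoc p.1 p.2) := hF.comp (measurable_fin_snoc t)
  rw [historyLaw, lintegral_map hF (measurable_fin_snoc t), Measure.lintegral_compProd hm]
  refine lintegral_congr fun h => ?_
  exact Kernel.lintegral_compProd (ALG.next t) (Kernel.prodMkLeft _ ρ) h
    (hm.comp measurable_prodMk_left)

lemma integral_historyLaw_succ (ALG : Algorithm) (ρ : Kernel unitInterval ℝ) [IsMarkovKernel ρ]
    (t : ℕ) {F : (Fin (t + 1) → unitInterval × ℝ) → ℝ} (hF : Measurable F) {K : ℝ}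
    (hK : ∀ h, |F h| ≤ K) :
    ∫ h, F h ∂(historyLaw ALG ρ (t + 1)) =
      ∫ h, ∫ a, ∫ r, F (Fin.snoc h (a, r)) ∂(ρ a) ∂(ALG.next t h) ∂(historyLaw ALG ρ t) := by
  have hm : Measurable fun p : (Fin t → unitInterval × ℝ) × (unitInterval × ℝ) =>
      F (Fin.snoc p.1 p.2) := hF.comp (measurable_fin_snoc t)
  rw [historyLaw, integral_map (measurable_fin_snoc t).aemeasurable hF.aestronglyMeasurable,
    Measure.integral_compProd
      (Integrable.of_bound hm.aestronglyMeasurable K (ae_of_all _ fun _ => hK _))]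
  refine integral_congr_ae (ae_of_all _ fun h => ?_)
  exact ProbabilityTheory.integral_compProd (κ := ALG.next t) (η := Kernel.prodMkLeft _ ρ) (a := h)
    (Integrable.of_bound (hm.comp measurable_prodMk_left).aestronglyMeasurable K
      (ae_of_all _ fun _ => hK _))

/-- If the conditional mean of `φ (a_t, R_t)` given the action is never positive, then
`∑ t, φ (a_t, R_t)` has nonpositive expectation. -/
lemma integral_sum_historyLaw_nonpos (ALG : Algorithm) (ρ : Kernel unitInterval ℝ)
    [IsMarkovKernel ρ] {φ : unitInterval × ℝ → ℝ} (hφ : Measurable φ) {K : ℝ}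
    (hK : ∀ p, |φ p| ≤ K) (h0 : ∀ a, ∫ r, φ (a, r) ∂(ρ a) ≤ 0) (t : ℕ) :
    ∫ h, ∑ i, φ (h i) ∂(historyLaw ALG ρ t) ≤ 0 := by
  induction t with
  | zero => simp
  | succ t ih =>
    have hmeas (t : ℕ) : Measurable fun h : Fin t → unitInterval × ℝ => ∑ i, φ (h i) := by fun_prop
    have hbd (t : ℕ) (h : Fin t → unitInterval × ℝ) : |∑ i, φ (h i)| ≤ t * K := by
      refine (Finset.abs_sum_le_sum_abs _ _).trans
        ((Finset.sum_le_sum fun i _ => hK (h i)).trans ?_)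
      simp
    rw [integral_historyLaw_succ ALG ρ t (hmeas _) (hbd _)]
    have hint (a : unitInterval) : Integrable (fun r => φ (a, r)) (ρ a) :=
      Integrable.of_bound (hφ.comp measurable_prodMk_left).aestronglyMeasurable K
        (ae_of_all _ fun _ => hK _)
    have hφ' : StronglyMeasurable fun a => ∫ r, φ (a, r) ∂(ρ a) :=
      StronglyMeasurable.integral_kernel_prod_right' (κ := ρ) hφ.stronglyMeasurable
    have hbd' (a : unitInterval) : ‖∫ r, φ (a, r) ∂(ρ a)‖ ≤ K := by
      simpa using norm_integral_le_of_norm_le_const (μ := ρ a) (f := fun r => φ (a, r))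
        (ae_of_all _ fun r => hK (a, r))
    have hint' (h : Fin t → unitInterval × ℝ) :
        Integrable (fun a => ∫ r, φ (a, r) ∂(ρ a)) (ALG.next t h) :=
      Integrable.of_bound hφ'.aestronglyMeasurable K (ae_of_all _ hbd')
    have hstep (h : Fin t → unitInterval × ℝ) :
        ∫ a, ∫ r, ∑ i, φ ((Fin.snoc h (a, r) : Fin (t + 1) → unitInterval × ℝ) i) ∂(ρ a)
          ∂(ALG.next t h) = ∑ i, φ (h i) + ∫ a, ∫ r, φ (a, r) ∂(ρ a) ∂(ALG.next t h) := by
      simp only [Fin.sum_univ_castSucc, Fin.snoc_castSucc, Fin.snoc_last]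
      have hin (a : unitInterval) : ∫ r, (∑ i, φ (h i) + φ (a, r)) ∂(ρ a) =
          ∑ i, φ (h i) + ∫ r, φ (a, r) ∂(ρ a) := by
        rw [integral_add (integrable_const _) (hint a)]
        simp
      simp_rw [hin]
      rw [integral_add (integrable_const _) (hint' h)]
      simp
    simp_rw [hstep]
    have hφ'' : Measurable fun h => ∫ a, ∫ r, φ (a, r) ∂(ρ a) ∂(ALG.next t h) :=
      (StronglyMeasurable.integral_kernel (κ := ALG.next t) hφ').measurable
    rw [integral_add (Integrable.of_bound (hmeas t).aestronglyMeasurable _ (ae_of_all _ (hbd t)))]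
    · exact add_nonpos ih (integral_nonpos fun h => integral_nonpos h0)
    · refine Integrable.of_bound hφ''.aestronglyMeasurable K (ae_of_all _ fun h => ?_)
      simpa using norm_integral_le_of_norm_le_const (μ := ALG.next t h) (ae_of_all _ hbd')

/-- The likelihood ratio of one round, given its action, between the Bernoulli rewards with mean
function `f` and those with constant mean `C / 2`. Outside the values `0` and `C` of the reward the
choice is immaterial; the value for `0` is used there to keep the function bounded. -/
noncomputable def rewardRatio (C : ℝ) (f : C(unitInterval, ℝ)) (p : unitInterval × ℝ) : ℝ :=
  if p.2 = C then 2 * f p.1 / C else 2 - 2 * f p.1 / C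

/-- The likelihood ratio of a history; the actions are chosen in the same way under both reward
functions, so that only the rewards contribute. -/
noncomputable def likelihoodRatio (C : ℝ) (f : C(unitInterval, ℝ)) {t : ℕ}
    (h : Fin t → unitInterval × ℝ) : ℝ :=
  ∏ i, rewardRatio C f (h i)

/-- The constant reward function `C / 2`, against which the bumps are compared. -/
noncomputable def flatReward (C : ℝ) : C(unitInterval, ℝ) := ContinuousMap.const _ (C / 2)

section Ratio

variable {C : ℝ} {f : C(unitInterval, ℝ)}

lemma measurable_rewardRatio (C : ℝ) (f : C(unitInterval, ℝ)) : Measurable (rewardRatio C f) := by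
  have hf : Measurable f := f.continuous.measurable
  exact Measurable.ite (measurable_snd (measurableSet_singleton C)) (by fun_prop) (by fun_prop)

lemma measurable_likelihoodRatio (C : ℝ) (f : C(unitInterval, ℝ)) (t : ℕ) :
    Measurable (likelihoodRatio C f (t := t)) := by
  have := measurable_rewardRatio C f
  unfold likelihoodRatio
  fun_prop

lemma rewardRatio_mem_Icc (hC : 0 < C) (hf : ∀ a, f a ∈ Icc (C / 2) (C / 2 + C / 4))
    (p : unitInterval × ℝ) : rewardRatio C f p ∈ Icc (1 / 2 : ℝ) (3 / 2) := by
  obtain ⟨h1, h2⟩ := hf p.1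
  have h3 : 1 ≤ 2 * f p.1 / C := by rw [le_div_iff₀ hC]; linarith
  have h4 : 2 * f p.1 / C ≤ 3 / 2 := by rw [div_le_iff₀ hC]; linarith
  unfold rewardRatio
  split_ifs <;> constructor <;> linarith

lemma rewardRatio_pos (hC : 0 < C) (hf : ∀ a, f a ∈ Icc (C / 2) (C / 2 + C / 4))
    (p : unitInterval × ℝ) : 0 < rewardRatio C f p :=
  lt_of_lt_of_le (by norm_num) (rewardRatio_mem_Icc hC hf p).1

lemma abs_log_rewardRatio_le (hC : 0 < C) (hf : ∀ a, f a ∈ Icc (C / 2) (C / 2 + C / 4))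
    (p : unitInterval × ℝ) : |Real.log (rewardRatio C f p)| ≤ 1 := by
  obtain ⟨h1, h2⟩ := rewardRatio_mem_Icc hC hf p
  have h0 := rewardRatio_pos hC hf p
  have h3 := Real.one_sub_inv_le_log_of_pos h0
  have h4 := Real.log_le_sub_one_of_pos h0
  have h5 : (rewardRatio C f p)⁻¹ ≤ 2 := by
    rw [inv_le_comm₀ h0 (by norm_num)]; linarith
  rw [abs_le]
  constructor <;> linarith

lemma likelihoodRatio_pos (hC : 0 < C) (hf : ∀ a, f a ∈ Icc (C / 2) (C / 2 + C / 4)) {t : ℕ}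
    (h : Fin t → unitInterval × ℝ) : 0 < likelihoodRatio C f h :=
  Finset.prod_pos fun i _ => rewardRatio_pos hC hf (h i)

lemma likelihoodRatio_le (hC : 0 < C) (hf : ∀ a, f a ∈ Icc (C / 2) (C / 2 + C / 4)) {t : ℕ}
    (h : Fin t → unitInterval × ℝ) : likelihoodRatio C f h ≤ (3 / 2) ^ t := by
  refine (Finset.prod_le_prod (fun i _ => (rewardRatio_pos hC hf (h i)).le)
    fun i _ => (rewardRatio_mem_Icc hC hf (h i)).2).trans_eq ?_
  rw [Finset.prod_const, Finset.card_univ, Fintype.card_fin]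

lemma log_likelihoodRatio (hC : 0 < C) (hf : ∀ a, f a ∈ Icc (C / 2) (C / 2 + C / 4)) {t : ℕ}
    (h : Fin t → unitInterval × ℝ) :
    Real.log (likelihoodRatio C f h) = ∑ i, Real.log (rewardRatio C f (h i)) :=
  Real.log_prod fun i _ => (rewardRatio_pos hC hf (h i)).ne'

lemma bernoulliReward_apply (C : ℝ) (f : C(unitInterval, ℝ)) (a : unitInterval) :
    bernoulliReward C f a = bernoulliMeasure C 0 (projIcc 0 1 zero_le_one (f a / C)) := rfl

lemma lintegral_bernoulliReward (hC : 0 < C) (hf : ∀ a, f a ∈ Icc 0 C) (a : unitInterval)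
    (F : ℝ → ℝ≥0∞) : ∫⁻ r, F r ∂(bernoulliReward C f a) =
      ENNReal.ofReal (f a / C) * F C + ENNReal.ofReal (1 - f a / C) * F 0 := by
  have hp : f a / C ∈ Icc (0 : ℝ) 1 :=
    ⟨div_nonneg (hf a).1 hC.le, (div_le_one hC).2 (hf a).2⟩
  have e1 : (unitInterval.toNNReal ⟨f a / C, hp⟩ : ℝ≥0∞) = ENNReal.ofReal (f a / C) := by
    rw [ENNReal.ofReal_eq_coe_nnreal hp.1]; rfl
  have e2 : (unitInterval.toNNReal (unitInterval.symm ⟨f a / C, hp⟩) : ℝ≥0∞) =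
      ENNReal.ofReal (1 - f a / C) := by
    rw [ENNReal.ofReal_eq_coe_nnreal (sub_nonneg.2 hp.2)]; rfl
  rw [bernoulliReward_apply, projIcc_of_mem _ hp, bernoulliMeasure_def, lintegral_add_measure,
    lintegral_smul_measure, lintegral_smul_measure, lintegral_dirac, lintegral_dirac]
  rw [ENNReal.smul_def, ENNReal.smul_def, e1, e2, smul_eq_mul, smul_eq_mul]

lemma integral_bernoulliReward_flatReward (hC : 0 < C) (a : unitInterval) (F : ℝ → ℝ) :
    ∫ r, F r ∂(bernoulliReward C (flatReward C) a) = (F C + F 0) / 2 := by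
  have h : flatReward C a / C = 1 / 2 := by
    simp only [flatReward, ContinuousMap.const_apply]
    field_simp
  rw [bernoulliReward_apply, integral_bernoulliMeasure, h, projIcc_of_mem _ (by norm_num)]
  simp only [smul_eq_mul]
  ring

/-- Change of measure for a single reward. -/
lemma lintegral_bernoulliReward_eq (hC : 0 < C) (hf : ∀ a, f a ∈ Icc 0 C) (a : unitInterval)
    (F : ℝ → ℝ≥0∞) : ∫⁻ r, F r ∂(bernoulliReward C f a) =
      ∫⁻ r, ENNReal.ofReal (rewardRatio C f (a, r)) * F r
        ∂(bernoulliReward C (flatReward C) a) := by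
  have hflat (a : unitInterval) : flatReward C a = C / 2 := rfl
  rw [lintegral_bernoulliReward hC hf,
    lintegral_bernoulliReward hC fun a => by rw [hflat]; constructor <;> linarith]
  have h : flatReward C a / C = 1 / 2 := by rw [hflat]; field_simp
  have h1 : rewardRatio C f (a, C) = 2 * f a / C := if_pos rfl
  have h2 : rewardRatio C f (a, 0) = 2 - 2 * f a / C := if_neg hC.ne
  rw [h, h1, h2, ← mul_assoc, ← mul_assoc, ← ENNReal.ofReal_mul (by norm_num),
    ← ENNReal.ofReal_mul (by norm_num)]
  congr <;> ring

/-- Change of measure for histories: `likelihoodRatio` is the density of the law under `f` with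
respect to the law under the constant rewards. -/
theorem historyLaw_eq_withDensity (hC : 0 < C) (hf : ∀ a, f a ∈ Icc (C / 2) (C / 2 + C / 4))
    (ALG : Algorithm) (t : ℕ) : historyLaw ALG (bernoulliReward C f) t =
      (historyLaw ALG (bernoulliReward C (flatReward C)) t).withDensity
        fun h => ENNReal.ofReal (likelihoodRatio C f h) := by
  have hf' (a : unitInterval) : f a ∈ Icc 0 C := ⟨by linarith [(hf a).1], by linarith [(hf a).2]⟩
  have hmΛ (t : ℕ) : Measurable fun h : Fin t → unitInterval × ℝ =>
      ENNReal.ofReal (likelihoodRatio C f h) := (measurable_likelihoodRatio C f t).ennreal_ofReal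
  suffices key : ∀ t (F : (Fin t → unitInterval × ℝ) → ℝ≥0∞), Measurable F →
      ∫⁻ h, F h ∂(historyLaw ALG (bernoulliReward C f) t) =
        ∫⁻ h, ENNReal.ofReal (likelihoodRatio C f h) * F h
          ∂(historyLaw ALG (bernoulliReward C (flatReward C)) t) by
    refine Measure.ext_of_lintegral _ fun F hF => ?_
    rw [key t F hF, lintegral_withDensity_eq_lintegral_mul _ (hmΛ t) hF]
    rfl
  intro t
  induction t with
  | zero =>
    intro F hF
    simp [historyLaw, likelihoodRatio]
  | succ t ih =>
    intro F hF
    have hFs := hF.comp (measurable_fin_snoc t)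
    have hr := (measurable_rewardRatio C f).ennreal_ofReal
    rw [lintegral_historyLaw_succ ALG _ t hF, lintegral_historyLaw_succ ALG _ t
        (F := fun h => ENNReal.ofReal (likelihoodRatio C f h) * F h) ((hmΛ _).mul hF), ih]
    · refine lintegral_congr fun h => ?_
      have hlast (a : unitInterval) : Measurable fun r => ENNReal.ofReal (rewardRatio C f (a, r)) *
          F (Fin.snoc h (a, r)) :=
        (hr.comp measurable_prodMk_left).mul
          (hFs.comp (measurable_prodMk_left.comp measurable_prodMk_left))
      have hsnoc (p : unitInterval × ℝ) :
          likelihoodRatio C f (Fin.snoc h p : Fin (t + 1) → unitInterval × ℝ) =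
            likelihoodRatio C f h * rewardRatio C f p := by
        simp only [likelihoodRatio, Fin.prod_univ_castSucc, Fin.snoc_castSucc, Fin.snoc_last]
      simp_rw [lintegral_bernoulliReward_eq hC hf', hsnoc,
        ENNReal.ofReal_mul (likelihoodRatio_pos hC hf h).le, mul_assoc]
      rw [← lintegral_const_mul' _ _ ENNReal.ofReal_ne_top]
      refine lintegral_congr fun a => ?_
      rw [← lintegral_const_mul _ (hlast a)]
    · have h1 : Measurable fun p : (Fin t → unitInterval × ℝ) × unitInterval =>
          ∫⁻ r, F (Fin.snoc p.1 (p.2, r)) ∂(bernoulliReward C f p.2) :=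
        Measurable.lintegral_kernel_prod_right' (κ := (Kernel.prodMkLeft _ (bernoulliReward C f)))
          (f := fun q : ((Fin t → unitInterval × ℝ) × unitInterval) × ℝ =>
            F (Fin.snoc q.1.1 (q.1.2, q.2)))
          (hFs.comp (g := fun p : (Fin t → unitInterval × ℝ) × (unitInterval × ℝ) => _)
            (f := fun q : ((Fin t → unitInterval × ℝ) × unitInterval) × ℝ => (q.1.1, (q.1.2, q.2)))
            (by fun_prop))
      exact Measurable.lintegral_kernel_prod_right' (κ := ALG.next t) h1

end Ratio

/-- The number of rounds whose action lies in `B`. -/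
noncomputable def visits (B : Set unitInterval) {t : ℕ} (h : Fin t → unitInterval × ℝ) : ℝ :=
  ∑ i, B.indicator 1 (h i).1

lemma measurable_visits {B : Set unitInterval} (hB : MeasurableSet B) (t : ℕ) :
    Measurable (visits B (t := t)) :=
  Finset.measurable_sum _ fun i _ => (measurable_one.indicator hB).comp
    (measurable_fst.comp (measurable_pi_apply i))

lemma visits_nonneg (B : Set unitInterval) {t : ℕ} (h : Fin t → unitInterval × ℝ) :
    0 ≤ visits B h :=
  Finset.sum_nonneg fun _ _ => indicator_nonneg (fun _ _ => zero_le_one) _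

lemma visits_le (B : Set unitInterval) {t : ℕ} (h : Fin t → unitInterval × ℝ) :
    visits B h ≤ t := by
  have h1 (a : unitInterval) : B.indicator (1 : unitInterval → ℝ) a ≤ 1 :=
    indicator_le_self' (fun _ _ => zero_le_one) a
  refine (Finset.sum_le_sum fun i _ => h1 (h i).1).trans_eq ?_
  simp

lemma integrable_visits {B : Set unitInterval} (hB : MeasurableSet B) {t : ℕ}
    (μ : Measure (Fin t → unitInterval × ℝ)) [IsFiniteMeasure μ] : Integrable (visits B) μ :=
  Integrable.of_bound (measurable_visits hB t).aestronglyMeasurable t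
    (ae_of_all _ fun h => by
      rw [Real.norm_eq_abs, abs_of_nonneg (visits_nonneg B h)]; exact visits_le B h)

/-- A pointwise substitute for Pinsker's inequality: integrated against a density `x` with respect
to a probability measure, it bounds the mean of `y` after the change of measure by twice the mean
before plus `2 T` times the relative entropy. It follows from `x ≤ 2 + 2 (√x - 1)²` and
`(√x - 1)² ≤ x - 1 - log x`. -/
lemma mul_le_two_mul_add_log {x y T : ℝ} (hx : 0 < x) (hy : 0 ≤ y) (hyT : y ≤ T) :
    x * y ≤ 2 * y + 2 * T * (x - 1 - Real.log x) := by
  have hs : Real.sqrt x ^ 2 = x := Real.sq_sqrt hx.le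
  have h1 : Real.log x ≤ 2 * (Real.sqrt x - 1) := by
    have := Real.log_le_sub_one_of_pos (Real.sqrt_pos.2 hx)
    rw [Real.log_sqrt hx.le] at this
    linarith
  have h2 : (Real.sqrt x - 1) ^ 2 ≤ x - 1 - Real.log x := by nlinarith
  have h3 : x ≤ 2 + 2 * (Real.sqrt x - 1) ^ 2 := by nlinarith [sq_nonneg (Real.sqrt x - 2)]
  calc x * y ≤ (2 + 2 * (Real.sqrt x - 1) ^ 2) * y := by gcongr
    _ = 2 * y + 2 * y * (Real.sqrt x - 1) ^ 2 := by ring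
    _ ≤ 2 * y + 2 * T * (x - 1 - Real.log x) := by
      have : 2 * y * (Real.sqrt x - 1) ^ 2 ≤ 2 * T * (x - 1 - Real.log x) :=
        mul_le_mul (by linarith) h2 (sq_nonneg _) (by linarith)
      linarith

/-- A bump of height `δ` supported in `B` multiplies the expected number of visits to `B` by at
most `2 (1 + T (2 δ / C)²)`: each visit to `B` adds at most `(2 δ / C)²` to the relative entropy of
the two laws, and the other rounds add nothing. -/
theorem integral_visits_le {C δ : ℝ} (hC : 0 < C) {f : C(unitInterval, ℝ)} {B : Set unitInterval}
    (hB : MeasurableSet B) (hδ : δ ≤ C / 4) (hf : ∀ a, f a ∈ Icc (C / 2) (C / 2 + δ))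
    (hfB : ∀ a ∉ B, f a = C / 2) (ALG : Algorithm) (T : ℕ) :
    ∫ h, visits B h ∂(historyLaw ALG (bernoulliReward C f) T) ≤
      2 * (1 + T * (2 * δ / C) ^ 2) *
        ∫ h, visits B h ∂(historyLaw ALG (bernoulliReward C (flatReward C)) T) := by
  have hf4 (a : unitInterval) : f a ∈ Icc (C / 2) (C / 2 + C / 4) :=
    ⟨(hf a).1, (hf a).2.trans (by linarith)⟩
  set P := historyLaw ALG (bernoulliReward C (flatReward C)) T with hP
  have hmΛ := measurable_likelihoodRatio C f T
  have hQ := historyLaw_eq_withDensity hC hf4 ALG T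
  have hintΛ : Integrable (likelihoodRatio C f (t := T)) P :=
    Integrable.of_bound hmΛ.aestronglyMeasurable ((3 / 2) ^ T) (ae_of_all _ fun h => by
      rw [Real.norm_eq_abs, abs_of_pos (likelihoodRatio_pos hC hf4 h)]
      exact likelihoodRatio_le hC hf4 h)
  have hmlog : Measurable fun p => Real.log (rewardRatio C f p) :=
    (measurable_rewardRatio C f).log
  have hintlog : Integrable (fun h => Real.log (likelihoodRatio C f (t := T) h)) P :=
    Integrable.of_bound hmΛ.log.aestronglyMeasurable T (ae_of_all _ fun h => by
      rw [log_likelihoodRatio hC hf4]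
      refine (norm_sum_le _ _).trans
        ((Finset.sum_le_sum fun i _ => abs_log_rewardRatio_le hC hf4 (h i)).trans_eq ?_)
      simp)
  have hintN : Integrable (visits B) P := integrable_visits hB P
  -- The density integrates to one.
  have hone : ∫ h, likelihoodRatio C f h ∂P = 1 := by
    have h1 : historyLaw ALG (bernoulliReward C f) T univ = 1 := measure_univ
    rw [hQ, withDensity_apply _ MeasurableSet.univ, Measure.restrict_univ] at h1
    rw [integral_eq_lintegral_of_nonneg_ae
      (ae_of_all _ fun h => (likelihoodRatio_pos hC hf4 h).le) hmΛ.aestronglyMeasurable, h1]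
    simp
  have hlog : -∫ h, Real.log (likelihoodRatio C f h) ∂P ≤
      (2 * δ / C) ^ 2 * ∫ h, visits B h ∂P := by
    have hmB : Measurable fun p : unitInterval × ℝ => B.indicator (1 : unitInterval → ℝ) p.1 :=
      (measurable_one.indicator hB).comp measurable_fst
    have h1 := integral_sum_historyLaw_nonpos ALG (bernoulliReward C (flatReward C))
      (φ := fun p => -Real.log (rewardRatio C f p) - (2 * δ / C) ^ 2 * B.indicator 1 p.1)
      (hmlog.neg.sub (hmB.const_mul _)) (K := 1 + (2 * δ / C) ^ 2) (fun p => ?_) (fun a => ?_) T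
    · have h2 : ∀ h : Fin T → unitInterval × ℝ,
          ∑ i, (-Real.log (rewardRatio C f (h i)) - (2 * δ / C) ^ 2 * B.indicator 1 (h i).1) =
            -Real.log (likelihoodRatio C f h) - (2 * δ / C) ^ 2 * visits B h := fun h => by
        rw [log_likelihoodRatio hC hf4, Finset.sum_sub_distrib, Finset.sum_neg_distrib, visits,
          Finset.mul_sum]
      simp_rw [h2] at h1
      rw [integral_sub (f := fun h => -Real.log (likelihoodRatio C f h)) hintlog.neg
        (hintN.const_mul _), integral_neg, integral_const_mul] at h1
      linarith
    · refine (abs_sub _ _).trans (add_le_add ?_ ?_)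
      · rw [abs_neg]; exact abs_log_rewardRatio_le hC hf4 p
      · rw [abs_mul, abs_of_nonneg (sq_nonneg _)]
        refine mul_le_of_le_one_right (sq_nonneg _) ?_
        by_cases hp : p.1 ∈ B <;> simp [hp]
    · rw [integral_bernoulliReward_flatReward hC]
      have e1 : rewardRatio C f (a, C) = 2 * f a / C := if_pos rfl
      have e2 : rewardRatio C f (a, 0) = 2 - 2 * f a / C := if_neg hC.ne
      simp only [e1, e2]
      by_cases ha : a ∈ B
      -- With success probabilities `(1 ± v) / 2`, the relative entropy of the reward is
      -- `-log (1 - v²) / 2 ≤ v²`.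
      · set v := 2 * f a / C - 1 with hv
        have hv0 : 0 ≤ v := by
          rw [hv, sub_nonneg, le_div_iff₀ hC]; linarith [(hf a).1]
        have hv1 : v ≤ 2 * δ / C := by
          rw [hv, sub_le_iff_le_add, div_add_one hC.ne']
          gcongr
          linarith [(hf a).2]
        have hv2 : v ≤ 1 / 2 := hv1.trans (by rw [div_le_iff₀ hC]; linarith)
        have hprod : Real.log (2 * f a / C) + Real.log (2 - 2 * f a / C) =
            Real.log (1 - v ^ 2) := by
          rw [← Real.log_mul (by linarith) (by linarith), hv]
          congr 1; ring
        have hw : 0 < 1 - v ^ 2 := by nlinarith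
        have hinv : (1 - v ^ 2)⁻¹ ≤ 1 + 2 * v ^ 2 := by
          rw [inv_le_iff_one_le_mul₀ hw]
          nlinarith [mul_nonneg (sq_nonneg v) (by nlinarith : 0 ≤ 1 - 2 * v ^ 2)]
        have h3 := Real.one_sub_inv_le_log_of_pos hw
        have h4 : v ^ 2 ≤ (2 * δ / C) ^ 2 := by gcongr
        simp only [indicator_of_mem ha, Pi.one_apply, mul_one]
        linarith
      · have : 2 * f a / C = 1 := by rw [hfB a ha]; field_simp
        rw [this]
        norm_num [ha]
  calc ∫ h, visits B h ∂(historyLaw ALG (bernoulliReward C f) T)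
      = ∫ h, likelihoodRatio C f h * visits B h ∂P := by
        rw [hQ, integral_withDensity_eq_integral_toReal_smul hmΛ.ennreal_ofReal
          (ae_of_all _ fun _ => ENNReal.ofReal_lt_top)]
        refine integral_congr_ae (ae_of_all _ fun h => ?_)
        simp only [ENNReal.toReal_ofReal (likelihoodRatio_pos hC hf4 h).le, smul_eq_mul]
    _ ≤ ∫ h, (2 * visits B h + 2 * T * (likelihoodRatio C f h - 1 -
          Real.log (likelihoodRatio C f h))) ∂P := by
        refine integral_mono_of_nonneg (ae_of_all _ fun h =>
          mul_nonneg (likelihoodRatio_pos hC hf4 h).le (visits_nonneg B h)) ?_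
          (ae_of_all _ fun h => mul_le_two_mul_add_log (likelihoodRatio_pos hC hf4 h)
            (visits_nonneg B h) (visits_le B h))
        exact (hintN.const_mul 2).add (((hintΛ.sub (integrable_const 1)).sub hintlog).const_mul _)
    _ = 2 * ∫ h, visits B h ∂P + 2 * T * -∫ h, Real.log (likelihoodRatio C f h) ∂P := by
        have h1 : Integrable (fun h => likelihoodRatio C f h - 1) P :=
          hintΛ.sub (integrable_const 1)
        have h2 : Integrable (fun h => 2 * T * (likelihoodRatio C f h - 1 -
            Real.log (likelihoodRatio C f h))) P := (h1.sub hintlog).const_mul _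
        rw [integral_add (hintN.const_mul 2) h2, integral_const_mul,
          integral_const_mul, integral_sub h1 hintlog,
          integral_sub hintΛ (integrable_const 1), hone]
        simp
    _ ≤ 2 * ∫ h, visits B h ∂P + 2 * T * ((2 * δ / C) ^ 2 * ∫ h, visits B h ∂P) := by gcongr
    _ = _ := by ring

/-! ### The regret lower bound -/

lemma sub_integral_visits_le_expectedRegret {C δ : ℝ} {f : C(unitInterval, ℝ)}
    {B : Set unitInterval} (hB : MeasurableSet B) (hf : ∀ a, f a ≤ C / 2 + δ)
    (hfB : ∀ a ∉ B, f a = C / 2) {x : unitInterval} (hx : f x = C / 2 + δ) (ALG : Algorithm)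
    (ρ : Kernel unitInterval ℝ) [IsMarkovKernel ρ] (T : ℕ) :
    δ * (T - ∫ h, visits B h ∂(historyLaw ALG ρ T)) ≤ expectedRegret ALG f ρ T := by
  have hsup : C / 2 + δ ≤ ⨆ a, f a := by
    rw [← hx]
    exact le_ciSup ⟨C / 2 + δ, by rintro _ ⟨a, rfl⟩; exact hf a⟩ x
  have hpt (h : Fin T → unitInterval × ℝ) :
      ∑ t, f (h t).1 ≤ T * (C / 2) + δ * visits B h := by
    have h1 (a : unitInterval) : f a ≤ C / 2 + δ * B.indicator 1 a := by
      by_cases ha : a ∈ B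
      · simpa [ha] using hf a
      · simp [ha, hfB a ha]
    refine (Finset.sum_le_sum fun t _ => h1 (h t).1).trans_eq ?_
    rw [Finset.sum_add_distrib, visits, Finset.mul_sum]
    simp
  have hfm : Measurable f := f.continuous.measurable
  have hfi (t : Fin T) : Integrable (fun h : Fin T → unitInterval × ℝ => f (h t).1)
      (historyLaw ALG ρ T) := by
    refine Integrable.of_bound (C := ‖f‖) (Measurable.aestronglyMeasurable (by fun_prop))
      (ae_of_all _ fun h => f.norm_coe_le_norm _)
  have hv := integrable_visits hB (historyLaw ALG ρ T)
  have hint : ∫ h, ∑ t : Fin T, f (h t).1 ∂(historyLaw ALG ρ T) ≤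
      T * (C / 2) + δ * ∫ h, visits B h ∂(historyLaw ALG ρ T) := by
    refine (integral_mono (integrable_finsetSum _ fun t _ => hfi t)
      ((integrable_const _).add (hv.const_mul δ)) hpt).trans_eq ?_
    rw [integral_add' (integrable_const _) (hv.const_mul δ)]
    simp [integral_const_mul]
  have hT : (T : ℝ) * (C / 2 + δ) ≤ T * ⨆ a, f a := by gcongr
  unfold expectedRegret
  linarith

/-- One of `n` disjoint regions gets at most its share of the visits. -/
lemma exists_mul_integral_visits_le {n : ℕ} (hn : 0 < n) {B : Fin n → Set unitInterval}
    (hB : ∀ j, MeasurableSet (B j)) (hdisj : Pairwise (Function.onFun Disjoint B)) {T : ℕ}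
    (μ : Measure (Fin T → unitInterval × ℝ)) [IsProbabilityMeasure μ] :
    ∃ j, n * ∫ h, visits (B j) h ∂μ ≤ T := by
  have h1 (a : unitInterval) : ∑ j, (B j).indicator (1 : unitInterval → ℝ) a ≤ 1 := by
    by_cases ha : ∃ j, a ∈ B j
    · obtain ⟨j, hj⟩ := ha
      rw [Finset.sum_eq_single j (fun k _ hk => indicator_of_notMem
        (fun hk' => (hdisj hk).le_bot ⟨hk', hj⟩) _) (by simp)]
      simp [hj]
    · push Not at ha
      simp [ha]
  have hpt (h : Fin T → unitInterval × ℝ) : ∑ j, visits (B j) h ≤ T := by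
    simp only [visits]
    rw [Finset.sum_comm]
    refine (Finset.sum_le_sum fun t _ => h1 (h t).1).trans_eq ?_
    simp
  have hv (j : Fin n) := integrable_visits (hB j) μ
  have hsum : ∑ j, ∫ h, visits (B j) h ∂μ ≤ T := by
    rw [← integral_finsetSum _ fun j _ => hv j]
    refine (integral_mono (integrable_finsetSum _ fun j _ => hv j) (integrable_const _)
      hpt).trans_eq ?_
    simp
  have : Nonempty (Fin n) := ⟨⟨0, hn⟩⟩
  by_contra! hcon
  have h2 : ∑ _j : Fin n, (T : ℝ) / n < ∑ j, ∫ h, visits (B j) h ∂μ := by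
    refine Finset.sum_lt_sum_of_nonempty Finset.univ_nonempty fun j _ => ?_
    rw [div_lt_iff₀' (by exact_mod_cast hn)]
    exact hcon j
  have h3 : (n : ℝ) ≠ 0 := by positivity
  rw [Finset.sum_const, Finset.card_univ, Fintype.card_fin, nsmul_eq_mul,
    mul_div_cancel₀ _ h3] at h2
  linarith

/-- `n` intervals of radius `r ≤ 1 / (2 n)` fit into `[0, 1]` side by side. -/
lemma exists_separated_centers {n : ℕ} {r : ℝ} (hr : 2 * n * r ≤ 1) :
    ∃ x : Fin n → unitInterval,
      Pairwise (Function.onFun Disjoint fun j => {a : unitInterval | |(a : ℝ) - x j| < r}) := by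
  rcases Nat.eq_zero_or_pos n with rfl | hn
  · exact ⟨fun j => j.elim0, fun j => j.elim0⟩
  have hn0 : (0 : ℝ) < n := by exact_mod_cast hn
  have hmem (j : Fin n) : (2 * (j : ℝ) + 1) / (2 * n) ∈ Icc (0 : ℝ) 1 := by
    have : (j : ℝ) + 1 ≤ n := by exact_mod_cast j.2
    refine ⟨by positivity, ?_⟩
    rw [div_le_one (by positivity)]
    linarith
  refine ⟨fun j => ⟨_, hmem j⟩, fun j k hjk => Set.disjoint_left.2 fun a hj hk => hjk ?_⟩
  simp only [mem_ofPred_eq] at hj hk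
  have h1 : |(2 * (j : ℝ) + 1) / (2 * n) - (2 * (k : ℝ) + 1) / (2 * n)| < 2 * r := by
    have := abs_sub_le ((2 * (j : ℝ) + 1) / (2 * n)) a ((2 * (k : ℝ) + 1) / (2 * n))
    rw [abs_sub_comm _ (a : ℝ)] at this
    linarith
  have h2 : (2 * (j : ℝ) + 1) / (2 * n) - (2 * (k : ℝ) + 1) / (2 * n) = (j - k) / n := by
    field_simp; ring
  rw [h2, abs_div, abs_of_pos hn0, div_lt_iff₀ hn0] at h1
  have h3 : |(j : ℝ) - k| < 1 := by linarith
  have h4 : |((j : ℕ) : ℤ) - ((k : ℕ) : ℤ)| < 1 := by exact_mod_cast h3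
  rw [Int.abs_lt_one_iff, sub_eq_zero] at h4
  exact Fin.ext (by exact_mod_cast h4)

/-- The regret bound before the choice of the width `s`. About `1 / (2 r)` bumps of support radius
`r = 2 ^ M s` fit into `[0, 1]`; `hinfo` says that the rounds that an algorithm facing constant
rewards spends in the least visited of them carry too little information to notice the bump there.
Then at least half of the rounds miss the bump, and each of them costs its height. -/
theorem exists_bumpReward_regret {C L s : ℝ} {M : ℕ} (hC : 0 < C) (hL : 0 < L) (hs : 0 < s)
    (hδ : L * s ^ (M + 1) * bumpSpline M 0 ≤ C / 4) (hr : 2 ^ M * s ≤ 1 / 32) {T : ℕ}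
    (hinfo : 64 * (2 ^ M * s) * (T * (L * s ^ (M + 1) * bumpSpline M 0) ^ 2) ≤ C ^ 2 / 2)
    (ALG : Algorithm) :
    ∃ x, L * s ^ (M + 1) * bumpSpline M 0 * (T / 2) ≤
      expectedRegret ALG (bumpReward C M L x s) (bernoulliReward C (bumpReward C M L x s)) T := by
  set δ := L * s ^ (M + 1) * bumpSpline M 0 with hδdef
  set r := 2 ^ M * s with hrdef
  have hφ := bumpSpline.zero_apply_pos M
  have hδ0 : 0 < δ := by positivity
  have hr0 : 0 < r := by positivity
  set n := ⌊1 / (2 * r)⌋₊ with hndef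
  have hn1 : (n : ℝ) ≤ 1 / (2 * r) := Nat.floor_le (by positivity)
  have hn2 : 1 / (4 * r) ≤ n := by
    have h1 : 1 / (2 * r) < n + 1 := Nat.lt_floor_add_one _
    have h2 : 1 ≤ 1 / (4 * r) := by rw [le_div_iff₀ (by positivity)]; linarith
    have h3 : 1 / (2 * r) = 2 * (1 / (4 * r)) := by field_simp; ring
    linarith
  have hn0 : (0 : ℝ) < n := lt_of_lt_of_le (by positivity) hn2
  -- This makes the factor in `integral_visits_le` at most `n / 2`.
  have hn : 4 * (1 + T * (2 * δ / C) ^ 2) ≤ n := by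
    refine le_trans ?_ hn2
    rw [le_div_iff₀ (by positivity)]
    have : 64 * r * (T * δ ^ 2) / C ^ 2 ≤ 1 / 2 := by
      rw [div_le_iff₀ (by positivity)]; linarith
    calc 4 * (1 + T * (2 * δ / C) ^ 2) * (4 * r) = 16 * r + 64 * r * (T * δ ^ 2) / C ^ 2 := by
          field_simp; ring
      _ ≤ 1 := by linarith
  obtain ⟨x, hx⟩ := exists_separated_centers (n := n) (r := r) (by
    rw [le_div_iff₀ (by positivity)] at hn1; linarith)
  have hB (j : Fin n) : MeasurableSet {a : unitInterval | |(a : ℝ) - x j| < r} :=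
    measurableSet_lt (by fun_prop) measurable_const
  obtain ⟨j, hj⟩ := exists_mul_integral_visits_le (by exact_mod_cast hn0) hB hx
    (historyLaw ALG (bernoulliReward C (flatReward C)) T)
  refine ⟨x j, ?_⟩
  have hbase : ∀ a ∉ {a : unitInterval | |(a : ℝ) - x j| < r},
      bumpReward C M L (x j) s a = C / 2 := fun a ha =>
    bumpReward.apply_eq_base hs (not_lt.1 ha)
  have hvis := integral_visits_le hC (hB j) hδ (bumpReward.mem_Icc_height hL hs (x j)) hbase ALG T
  have hreg := sub_integral_visits_le_expectedRegret (hB j)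
    (fun a => (bumpReward.mem_Icc_height (C := C) (M := M) hL hs (x j) a).2) hbase
    (bumpReward.isBump hL hs (x j)).apply_center ALG
    (bernoulliReward C (bumpReward C M L (x j) s)) T
  refine le_trans ?_ hreg
  set V := ∫ h, visits {a : unitInterval | |(a : ℝ) - x j| < r} h
    ∂(historyLaw ALG (bernoulliReward C (flatReward C)) T)
  have hV : 0 ≤ V := integral_nonneg fun h => visits_nonneg _ h
  have h1 : 4 * (1 + T * (2 * δ / C) ^ 2) * V ≤ T := by
    refine le_trans ?_ hj
    gcongr
  gcongr
  linarith

theorem theorem5 (M : ℕ) :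
    ∃ w : ℝ, 0 < w ∧ ∀ C L : ℝ, 0 < C → 0 < L →
      ∃ c : ℝ, 0 < c ∧ ∀ T : ℕ, 1 ≤ T → ∀ ALG : Algorithm,
        ∃ (x : unitInterval) (δ : ℝ) (ν : C(unitInterval, ℝ)),
          0 < δ ∧
          ν ∈ smoothRewards C M L ∧
          IsBump C M L x δ (w * (δ / L) ^ (1 / ((M : ℝ) + 1))) ν ∧
          (∀ b : ℝ, 0 < b → IsSubExponentialReward (bernoulliReward C ν) ν (C / 2) b) ∧
          c * (T : ℝ) ^ (((M : ℝ) + 2) / (2 * (M : ℝ) + 3)) ≤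
            expectedRegret ALG ν (bernoulliReward C ν) T := by
  obtain ⟨K, hK1, hK⟩ := bumpSpline.exists_lipschitz M
  set φ := bumpSpline M 0 with hφdef
  have hφ : 0 < φ := bumpSpline.zero_apply_pos M
  refine ⟨2 ^ M * (φ ^ (1 / ((M : ℝ) + 1)))⁻¹, by positivity, fun C L hC hL => ?_⟩
  -- `σ K ≤ 1` gives smoothness, the next bound the height `δ ≤ C / 4`, the third the radius at most
  -- `1 / 32`, the last the smallness of `r T δ²`.
  obtain ⟨σ, hσ0, hσK, hσδ, hσr, hσinfo⟩ : ∃ σ : ℝ, 0 < σ ∧ σ * K ≤ 1 ∧ σ * (4 * L * φ / C) ≤ 1 ∧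
      σ * (32 * 2 ^ M) ≤ 1 ∧ σ * (128 * 2 ^ M * L ^ 2 * φ ^ 2 / C ^ 2) ≤ 1 := by
    have hpos : ∀ {y A : ℝ}, 0 < A → y ≤ A → A⁻¹ * y ≤ 1 := fun hA hy => by
      rw [inv_mul_le_iff₀ hA]; linarith
    have h1 : 0 < 4 * L * φ / C := by positivity
    have h2 : (0 : ℝ) < 32 * 2 ^ M := by positivity
    have h3 : 0 < 128 * 2 ^ M * L ^ 2 * φ ^ 2 / C ^ 2 := by positivity
    refine ⟨(K + 4 * L * φ / C + 32 * 2 ^ M + 128 * 2 ^ M * L ^ 2 * φ ^ 2 / C ^ 2)⁻¹,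
      by positivity, hpos ?_ ?_, hpos ?_ ?_, hpos ?_ ?_, hpos ?_ ?_⟩ <;> linarith
  have hσ1 : σ ≤ 1 := (le_mul_of_one_le_right hσ0.le hK1).trans hσK
  refine ⟨L * σ ^ (M + 1) * φ / 2, by positivity, fun T hT ALG => ?_⟩
  have hT1 : (1 : ℝ) ≤ T := by exact_mod_cast hT
  have hT0 : (0 : ℝ) < T := by linarith
  -- The width of the bump is `σ τ`.
  set τ : ℝ := (T : ℝ) ^ (-(1 / (2 * (M : ℝ) + 3))) with hτdef
  have hτ0 : 0 < τ := Real.rpow_pos_of_pos hT0 _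
  have hτ1 : τ ≤ 1 := Real.rpow_le_one_of_one_le_of_nonpos hT1 (by
    have : 0 < 1 / (2 * (M : ℝ) + 3) := by positivity
    linarith)
  have hτpow : τ ^ (2 * M + 3) * T = 1 := by
    rw [hτdef, ← Real.rpow_natCast, ← Real.rpow_mul hT0.le]
    have : -(1 / (2 * (M : ℝ) + 3)) * ((2 * M + 3 : ℕ) : ℝ) = -1 := by push_cast; field_simp
    rw [this, Real.rpow_neg_one, inv_mul_cancel₀ hT0.ne']
  have hτrate : τ ^ (M + 1) * T = (T : ℝ) ^ (((M : ℝ) + 2) / (2 * (M : ℝ) + 3)) := by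
    rw [hτdef, ← Real.rpow_natCast, ← Real.rpow_mul hT0.le]
    nth_rewrite 2 [← Real.rpow_one (T : ℝ)]
    rw [← Real.rpow_add hT0]
    congr 1
    push_cast
    field_simp
    ring
  have hs0 : 0 < σ * τ := by positivity
  have hsσ : σ * τ ≤ σ := mul_le_of_le_one_right hσ0.le hτ1
  have hspow : (σ * τ) ^ (M + 1) ≤ σ := by
    refine le_trans ?_ hsσ
    exact pow_le_of_le_one hs0.le (hsσ.trans hσ1) (by omega)
  have hδ4 : L * (σ * τ) ^ (M + 1) * φ ≤ C / 4 := by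
    rw [← mul_div_assoc, div_le_one hC] at hσδ
    calc L * (σ * τ) ^ (M + 1) * φ ≤ L * σ * φ := by gcongr
      _ ≤ C / 4 := by linarith
  have hr : 2 ^ M * (σ * τ) ≤ 1 / 32 := by
    calc 2 ^ M * (σ * τ) ≤ 2 ^ M * σ := by gcongr
      _ ≤ 1 / 32 := by linarith
  have hinfo : 64 * (2 ^ M * (σ * τ)) * (T * (L * (σ * τ) ^ (M + 1) * φ) ^ 2) ≤ C ^ 2 / 2 := by
    rw [← mul_div_assoc, div_le_one (by positivity)] at hσinfo
    calc 64 * (2 ^ M * (σ * τ)) * (T * (L * (σ * τ) ^ (M + 1) * φ) ^ 2)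
        = 64 * 2 ^ M * L ^ 2 * φ ^ 2 * σ ^ (2 * M + 3) * (τ ^ (2 * M + 3) * T) := by ring
      _ ≤ 64 * 2 ^ M * L ^ 2 * φ ^ 2 * σ := by
        rw [hτpow, mul_one]
        gcongr
        exact pow_le_of_le_one hσ0.le hσ1 (by omega)
      _ ≤ C ^ 2 / 2 := by linarith
  obtain ⟨x, hx⟩ := exists_bumpReward_regret hC hL hs0 hδ4 hr hinfo ALG
  have hmem : bumpReward C M L x (σ * τ) ∈ smoothRewards C M L :=
    bumpReward.mem_smoothRewards hC hL hs0 (hsσ.trans hσ1) (by linarith) hK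
      ((mul_le_mul_of_nonneg_right hsσ (by linarith)).trans hσK) (hδ4.trans (by linarith)) x
  refine ⟨x, L * (σ * τ) ^ (M + 1) * φ, bumpReward C M L x (σ * τ), by positivity, hmem, ?_,
    fun b _ => isSubExponentialReward_bernoulliReward hC hmem.1 b, ?_⟩
  · have hrad : 2 ^ M * (φ ^ (1 / ((M : ℝ) + 1)))⁻¹ *
        (L * (σ * τ) ^ (M + 1) * φ / L) ^ (1 / ((M : ℝ) + 1)) = 2 ^ M * (σ * τ) := by
      have h1 : L * (σ * τ) ^ (M + 1) * φ / L = (σ * τ) ^ (M + 1) * φ := by field_simp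
      have h2 : ((σ * τ) ^ (M + 1)) ^ (1 / ((M : ℝ) + 1)) = σ * τ := by
        have := Real.pow_rpow_inv_natCast hs0.le (Nat.succ_ne_zero M)
        rw [one_div]
        exact_mod_cast this
      have h3 : φ ^ (1 / ((M : ℝ) + 1)) ≠ 0 := by positivity
      rw [h1, Real.mul_rpow (by positivity) hφ.le, h2]
      field_simp
    rw [hrad]
    exact bumpReward.isBump hL hs0 x
  · refine le_trans (le_of_eq ?_) hx
    rw [← hτrate, mul_pow]
    ring
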